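/- All matroids and digraphs are finite. Let $k\ge 1$ be an integer. A matroid $M$ is \emph{$k$-base-orderable} if for any two bases $B_1,B_2$ of $M$ there is a bijection $\sigma\colon B_1\to B_2$ such that, for every $X\subseteq B_1$ with $|X|\le k$, both $(B_1-X)\cup\sigma(X)$ and $(B_2-\sigma(X))\cup X$ are bases of $M$. \textbf{Theorem.} For every fixed $k\ge 1$, the class $k$-$\mathcal{BO}$ of $k$-base-orderable matroids is \emph{complete}, that is, it is closed under isomorphism and under minors, duals, direct sums, truncations and induction by directed graphs. Here the truncation of $M$ is $(M+_{E(M)}e)/e$ with $e\notin E(M)$, where, for $Y\subseteq E(M)$, the principal extension $M+_Y e$ is the matroid on $E(M)\cup\{e\}$ whose rank function agrees with $r_M$ on subsets of $E(M)$ and satisfies $r_{M+_Ye}(X\cup e)=\min\{r_M(X)+1,\ r_M(X\cup Y)\}$ for $X\subseteq E(M)$. For a digraph $\Gamma$ and a matroid $M$ with $E(M)\subseteq V(\Gamma)$, the induced matroid $\Gamma(M)$ is the matroid on $V(\Gamma)$ in which a set $I$ is independent if and only if it can be linked to an independent set $J$ of $M$, i.e. there are $|I|=|J|$ pairwise vertex-disjoint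 directed paths in $\Gamma$ (single vertices allowed) whose set of initial vertices is $I$ and whose set of terminal vertices is $J$. Both of these matroids exist. -/

import Mathlib

open Set

universe u v

namespace MatroidClass

/-- A `k`-exchange-ordering for the bases `B₁`, `B₂` of `M`: a bijection `σ` from `B₁` to `B₂` such
that for every `X ⊆ B₁` with `|X| ≤ k`, both `(B₁ - X) ∪ σ(X)` and `(B₂ - σ(X)) ∪ X` are bases.
Only the values of `σ` on `B₁` matter. -/
def IsExchangeOrdering {α : Type u} (M : Matroid α) (k : ℕ) (B₁ B₂ : Set α) (σ : α → α) : Prop :=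
  BijOn σ B₁ B₂ ∧ ∀ X ⊆ B₁, X.encard ≤ k →
    M.IsBase ((B₁ \ X) ∪ σ '' X) ∧ M.IsBase ((B₂ \ σ '' X) ∪ X)

/-- `M` is `k`-base-orderable: each pair of its bases has a `k`-exchange-ordering. -/
def IsBaseOrderable {α : Type u} (k : ℕ) (M : Matroid α) : Prop :=
  ∀ B₁ B₂ : Set α, M.IsBase B₁ → M.IsBase B₂ → ∃ σ : α → α, IsExchangeOrdering M k B₁ B₂ σ

/-- The class `k`-BO of all (finite) `k`-base-orderable matroids. -/
def kBO (k : ℕ) ⦃α : Type u⦄ (M : Matroid α) : Prop :=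
  M.Finite ∧ IsBaseOrderable k M

/-- `M` and `N` are isomorphic: some bijection between the ground sets preserves independence in
both directions. -/
def IsIsomorphic {α : Type u} {β : Type v} (M : Matroid α) (N : Matroid β) : Prop :=
  ∃ φ : M.E ≃ N.E, ∀ I : Set M.E,
    M.Indep (Subtype.val '' I) ↔ N.Indep (Subtype.val '' (φ '' I))

/-- `N` is the principal extension `M +_Y e`: `Y ⊆ E(M)`, `e ∉ E(M)`, `N` has ground set
`E(M) ∪ {e}`, and for `X ⊆ E(M)` its rank function satisfies `r_N(X) = r_M(X)` and
`r_N(X ∪ e) = min {r_M(X) + 1, r_M(X ∪ Y)}`. -/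
structure IsPrincipalExtension {α : Type u} (M : Matroid α) (Y : Set α) (e : α)
    (N : Matroid α) : Prop where
  subset_ground : Y ⊆ M.E
  notMem_ground : e ∉ M.E
  ground_eq : N.E = insert e M.E
  rank_eq : ∀ X ⊆ M.E, N.eRk X = M.eRk X
  rank_insert_eq : ∀ X ⊆ M.E, N.eRk (insert e X) = min (M.eRk X + 1) (M.eRk (X ∪ Y))

/-- `T` is the truncation of `M`, that is, `T = (M +_{E(M)} e) / e`. To have a new element `e` at
hand, `M` and `T` are copied along `some : α ↪ Option α`, and `e` is `none`. -/
def IsTruncation {α : Type u} (M T : Matroid α) : Prop :=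
  ∃ N : Matroid (Option α),
    IsPrincipalExtension (M.mapEmbedding .some) (M.mapEmbedding .some).E none N ∧
      T.mapEmbedding .some = N.contract {none}

/-- `p` is the list of vertices of a directed path in `Γ` from `x` to `y` (possibly with `x = y` and
no arcs). -/
structure IsDirectedPath {V : Type u} (Γ : Digraph V) (p : List V) (x y : V) : Prop where
  isChain : p.IsChain Γ.Adj
  nodup : p.Nodup
  head_eq : p.head? = some x
  last_eq : p.getLast? = some y

/-- `X` is linked to `Y` in `Γ`: there are pairwise vertex-disjoint directed paths, one starting at
each element of `X`, whose end vertices are, bijectively, the elements of `Y`. -/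
def IsLinked {V : Type u} (Γ : Digraph V) (X Y : Set V) : Prop :=
  ∃ (t : V → V) (p : V → List V), BijOn t X Y ∧
    (∀ x ∈ X, IsDirectedPath Γ (p x) x (t x)) ∧
    ∀ x ∈ X, ∀ x' ∈ X, x ≠ x' → (p x).Disjoint (p x')

/-- `N` is the matroid `Γ(M)` on the whole vertex set of `Γ` that is induced from `M` by the
digraph `Γ`: a set is independent if and only if it can be linked to an independent set of `M`. -/
def IsInduced {V : Type u} (Γ : Digraph V) (M N : Matroid V) : Prop :=
  N.E = univ ∧ ∀ I : Set V, N.Indep I ↔ ∃ J : Set V, M.Indep J ∧ IsLinked Γ I J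

/-- A collection of finite matroids, closed under isomorphism. -/
structure IsMatroidClass (C : ∀ ⦃α : Type u⦄, Matroid α → Prop) : Prop where
  finite : ∀ {α : Type u} (M : Matroid α), C M → M.Finite
  isomorphic : ∀ {α β : Type u} (M : Matroid α) (N : Matroid β), C M → IsIsomorphic M N → C N

/-- A class of matroids is complete if it is closed under minors, duals, direct sums, truncations
and induction by directed graphs. For the last two operations, which are described by a relation,
closure means that the result exists and lies in the class. -/
structure IsComplete (C : ∀ ⦃α : Type u⦄, Matroid α → Prop) : Prop extends IsMatroidClass C where
  minor : ∀ {α : Type u} (M N : Matroid α), C M → N.IsMinor M → C N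
  dual : ∀ {α : Type u} (M : Matroid α), C M → C M.dual
  directSum : ∀ {α β : Type u} (M : Matroid α) (N : Matroid β), C M → C N → C (M.sum N)
  truncation : ∀ {α : Type u} (M : Matroid α), C M →
    (∃ T : Matroid α, IsTruncation M T) ∧ ∀ T : Matroid α, IsTruncation M T → C T
  induction : ∀ {V : Type u} [Finite V] (Γ : Digraph V) (M : Matroid V), C M →
    (∃ N : Matroid V, IsInduced Γ M N) ∧ ∀ N : Matroid V, IsInduced Γ M N → C N

end MatroidClass

/-!
The operations reduce to four: duality, restriction, principal extension and direct sum.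

*Fixed points.* As `k ≥ 1`, exchanging single elements shows that a `k`-exchange-ordering
`σ : B₁ → B₂` is the identity on `B₁ ∩ B₂` and sends no other element of `B₁` into `B₁`. Hence for
the dual matroid one inverts `σ` off the intersection (`IsBaseOrderable.dual`), and for a
restriction one extends two bases by a common set, which the ordering must fix
(`IsBaseOrderable.restrict`). Together these give minors.

*Principal extension* (`IsBaseOrderable.princExt`). In a base of `M +_Y e` that contains `e`, some
`y ∈ Y` can take the place of `e`, so an ordering `τ` of `M` is available. The delicate case is that
of two bases `C₁ ∪ e`, `C₂ ∪ e` with `τ : C₁ ∪ y₁ → C₂ ∪ y₂`, `τ y₁ = d` and `τ c = y₂`, for `d ≠ y₂`.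
Then `e` is fixed and `c` is sent to `d`. If the exchanged set contains `c`, applying `τ` to it, and
to the set with `y₁` in place of `c`, gives bases `Z ∪ {y₁, y₂}` and `Z ∪ {c, d}` of `M`. By base
exchange, `y₁` or `y₂` extends `Z ∪ d` to a base, which is the first exchange condition; the second
is obtained in the same way with another set `Z` and with `Z ∪ c`. The number of exchanged
elements never grows, which is what makes the argument work for fixed `k`. Truncations are
contractions of principal extensions.

*Induction.* Adding the vertices of one side of a bipartite graph by principal extensions along their
neighbourhoods, and then deleting the other side, gives the matroid induced by a bipartite graph
(`exists_kBO_indep_iff`). For a digraph `Γ`, a set `I` is linked to `J` if and only if there is a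
bijection from the complement of `I` to that of `J` that moves each vertex at most to an in-neighbour
(`IsLinked.exists_isBackMatching`, `IsBackMatching.isLinked`). Therefore `Γ(M)` is the dual of the
matroid that a bipartite graph induces from the dual of `M` (`kBO.exists_isInduced`).
-/

namespace MatroidClass

open scoped Matroid

/-! ### Exchange orderings -/

section ExchangeOrdering

variable {α : Type u} {M : Matroid α} {k : ℕ} {B₁ B₂ : Set α} {σ : α → α}

lemma IsExchangeOrdering.mapsTo (h : IsExchangeOrdering M k B₁ B₂ σ) : MapsTo σ B₁ B₂ := h.1.mapsTo

lemma IsExchangeOrdering.isBase_left (h : IsExchangeOrdering M k B₁ B₂ σ) : M.IsBase B₁ := by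
  simpa using (h.2 ∅ (empty_subset _) (by simp)).1

lemma IsExchangeOrdering.isBase_right (h : IsExchangeOrdering M k B₁ B₂ σ) : M.IsBase B₂ := by
  simpa using (h.2 ∅ (empty_subset _) (by simp)).2

/-- Exchanging `x` for `σ x` must not lower the cardinality of `B₁`. -/
lemma IsExchangeOrdering.eq_of_mem_left (hk : 1 ≤ k) (h : IsExchangeOrdering M k B₁ B₂ σ) {x : α}
    (hx : x ∈ B₁) (hσ : σ x ∈ B₁) : σ x = x := by
  by_contra hne
  have hb := (h.2 {x} (by simpa) (by simpa using hk)).1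
  have hx' : x ∈ B₁ \ {x} ∪ σ '' {x} := by
    rw [hb.eq_of_subset_isBase h.isBase_left ?_]
    · exact hx
    · rintro y (hy | ⟨_, rfl, rfl⟩)
      exacts [hy.1, hσ]
  obtain (h1 | ⟨y, rfl, h1⟩) := hx'
  exacts [h1.2 rfl, hne h1]

/-- Exchanging `σ x` for `x` must not lower the cardinality of `B₂`. -/
lemma IsExchangeOrdering.eq_of_mem_right (hk : 1 ≤ k) (h : IsExchangeOrdering M k B₁ B₂ σ) {x : α}
    (hx : x ∈ B₁) (hx₂ : x ∈ B₂) : σ x = x := by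
  by_contra hne
  have hb := (h.2 {x} (by simpa) (by simpa using hk)).2
  have hx' : σ x ∈ B₂ \ σ '' {x} ∪ {x} := by
    rw [hb.eq_of_subset_isBase h.isBase_right ?_]
    · exact h.mapsTo hx
    · rintro y (hy | rfl)
      exacts [hy.1, hx₂]
  obtain (h1 | h1) := hx'
  exacts [h1.2 ⟨x, rfl, rfl⟩, hne h1]

lemma IsExchangeOrdering.symm [Nonempty α] (h : IsExchangeOrdering M k B₁ B₂ σ) :
    IsExchangeOrdering M k B₂ B₁ (Function.invFunOn σ B₁) := by
  have hinv : InvOn (Function.invFunOn σ B₁) σ B₁ B₂ := h.1.invOn_invFunOn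
  have hbij : BijOn (Function.invFunOn σ B₁) B₂ B₁ := h.1.symm hinv.symm
  refine ⟨hbij, fun X hX hXk ↦ ?_⟩
  have himg : σ '' (Function.invFunOn σ B₁ '' X) = X := by
    rw [image_image]
    conv_rhs => rw [← image_id X]
    exact image_congr fun x hx ↦ hinv.2 (hX hx)
  have := h.2 (Function.invFunOn σ B₁ '' X) ((image_mono hX).trans hbij.image_eq.subset)
    ((encard_image_le _ _).trans hXk)
  rw [himg] at this
  exact this.symm

/-- An element `e` of both bases that is fixed by `σ` never matters, so that only the sets avoiding
it have to be tested. -/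
lemma isExchangeOrdering_of_fixed {e : α} (hσ : BijOn σ B₁ B₂) (h₁ : e ∈ B₁) (h₂ : e ∈ B₂)
    (hfix : σ e = e)
    (h : ∀ X ⊆ B₁, e ∉ X → X.encard ≤ k →
      M.IsBase ((B₁ \ X) ∪ σ '' X) ∧ M.IsBase ((B₂ \ σ '' X) ∪ X)) :
    IsExchangeOrdering M k B₁ B₂ σ := by
  refine ⟨hσ, fun X hX hXk ↦ ?_⟩
  by_cases heX : e ∈ X
  · obtain ⟨X₀, rfl, he₀⟩ : ∃ X₀, X = insert e X₀ ∧ e ∉ X₀ := ⟨X \ {e}, by simp [heX], by simp⟩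
    have hX₀ : X₀ ⊆ B₁ := (subset_insert _ _).trans hX
    have he₁ : e ∉ σ '' X₀ := by
      rintro ⟨x, hx, hxe⟩
      have := hσ.injOn (hX₀ hx) h₁ (hxe.trans hfix.symm)
      exact he₀ (this ▸ hx)
    have := h X₀ hX₀ he₀ ((encard_le_encard (subset_insert _ _)).trans hXk)
    have e1 : B₁ \ insert e X₀ ∪ σ '' insert e X₀ = (B₁ \ X₀) ∪ σ '' X₀ := by
      rw [image_insert_eq, hfix]
      ext z
      by_cases hz : z = e
      · subst hz; simp [h₁, he₀]
      · simp [hz]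
    have e2 : B₂ \ σ '' insert e X₀ ∪ insert e X₀ = (B₂ \ σ '' X₀) ∪ X₀ := by
      rw [image_insert_eq, hfix]
      ext z
      by_cases hz : z = e
      · subst hz; simp only [h₂, he₁, mem_union, mem_sdiff, mem_insert_iff]; tauto
      · simp [hz]
    rwa [e1, e2]
  · exact h X hX heX hXk

end ExchangeOrdering

/-! ### Duals and minors -/

section MinorDual

variable {α : Type u} {M N : Matroid α} {k : ℕ}

/-- On `B₂ \ B₁` the dual ordering inverts the given one; elsewhere it is the identity. -/
lemma IsBaseOrderable.dual (hk : 1 ≤ k) (h : IsBaseOrderable k M) : IsBaseOrderable k M✶ := by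
  classical
  intro D₁ D₂ hD₁ hD₂
  rw [Matroid.dual_isBase_iff'] at hD₁ hD₂
  obtain ⟨hB₁, hD₁E⟩ := hD₁
  obtain ⟨hB₂, hD₂E⟩ := hD₂
  obtain hα | hα := isEmpty_or_nonempty α
  · refine ⟨id, ?_⟩
    have : D₁ = D₂ := Subsingleton.elim _ _
    subst this
    refine ⟨bijOn_id _, fun X hX _ ↦ ?_⟩
    simp [sdiff_union_of_subset hX, hB₁]
  set B₁ := M.E \ D₁ with hB₁def
  set B₂ := M.E \ D₂ with hB₂def
  obtain ⟨τ, hτ⟩ := h B₂ B₁ hB₂ hB₁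
  have hτfix : ∀ x ∈ B₂, x ∈ B₁ → τ x = x := fun x hx hx' ↦ hτ.eq_of_mem_right hk hx hx'
  have hτB₂ : ∀ x ∈ B₂, τ x ∈ B₂ → τ x = x := fun x hx hx' ↦ hτ.eq_of_mem_left hk hx hx'
  have hτmaps : ∀ x ∈ B₂, τ x ∈ B₁ := fun x hx ↦ hτ.mapsTo hx
  have key : ∀ x, x ∈ D₁ → x ∉ D₂ → τ x ∈ D₂ ∧ τ x ∉ D₁ := by
    intro x h1 h2
    have hx : x ∈ B₂ := ⟨hD₁E h1, h2⟩
    have h3 := hτmaps x hx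
    refine ⟨?_, h3.2⟩
    by_contra h4
    have := hτB₂ x hx ⟨h3.1, h4⟩
    rw [this] at h3
    exact h3.2 h1
  have hinj := hτ.1.injOn
  set σ : α → α := fun x ↦ if x ∈ D₂ then x else τ x with hσ
  have hσ1 : ∀ x, x ∈ D₂ → σ x = x := fun x hx ↦ by simp [hσ, hx]
  have hσ2 : ∀ x, x ∉ D₂ → σ x = τ x := fun x hx ↦ by simp [hσ, hx]
  have hbij : BijOn σ D₁ D₂ := by
    refine ⟨fun x hx ↦ ?_, fun x hx y hy hxy ↦ ?_, fun y hy ↦ ?_⟩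
    · by_cases h2 : x ∈ D₂
      · rwa [hσ1 x h2]
      · rw [hσ2 x h2]; exact (key x hx h2).1
    · by_cases hx2 : x ∈ D₂ <;> by_cases hy2 : y ∈ D₂
      · rwa [hσ1 x hx2, hσ1 y hy2] at hxy
      · rw [hσ1 x hx2, hσ2 y hy2] at hxy
        exact absurd (hxy ▸ hx) (key y hy hy2).2
      · rw [hσ2 x hx2, hσ1 y hy2] at hxy
        exact absurd (hxy ▸ hy) (key x hx hx2).2
      · rw [hσ2 x hx2, hσ2 y hy2] at hxy
        exact hinj ⟨hD₁E hx, hx2⟩ ⟨hD₁E hy, hy2⟩ hxy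
    · by_cases hy1 : y ∈ D₁
      · exact ⟨y, hy1, hσ1 y hy⟩
      · obtain ⟨x, hx, rfl⟩ := hτ.1.surjOn (show y ∈ B₁ from ⟨hD₂E hy, hy1⟩)
        refine ⟨x, ?_, hσ2 x hx.2⟩
        by_contra hx1
        have := hτfix x hx ⟨hx.1, hx1⟩
        exact hx.2 (this ▸ hy)
  refine ⟨σ, hbij, fun X hX hXk ↦ ?_⟩
  have hXE := hX.trans hD₁E
  -- Only the part of `X` outside `D₂` is really exchanged.
  have hA : X \ D₂ ⊆ B₂ := fun x hx ↦ ⟨hXE hx.1, hx.2⟩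
  obtain ⟨hb₂, hb₁⟩ := hτ.2 (X \ D₂) hA ((encard_le_encard sdiff_subset).trans hXk)
  have himg : ∀ z, z ∈ σ '' X ↔ (z ∈ X ∧ z ∈ D₂) ∨ z ∈ τ '' (X \ D₂) := by
    intro z
    constructor
    · rintro ⟨x, hx, rfl⟩
      by_cases hx2 : x ∈ D₂
      · rw [hσ1 x hx2]; exact .inl ⟨hx, hx2⟩
      · rw [hσ2 x hx2]; exact .inr ⟨x, ⟨hx, hx2⟩, rfl⟩
    · rintro (⟨hz, hz2⟩ | ⟨x, hx, rfl⟩)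
      · exact ⟨z, hz, hσ1 z hz2⟩
      · exact ⟨x, hx.1, hσ2 x hx.2⟩
  have hτimg : ∀ z, z ∈ τ '' (X \ D₂) → z ∈ D₂ ∧ z ∉ D₁ ∧ z ∈ M.E := by
    rintro _ ⟨x, hx, rfl⟩
    have := key x (hX hx.1) hx.2
    exact ⟨this.1, this.2, hD₂E this.1⟩
  constructor
  · rw [Matroid.dual_isBase_iff']
    refine ⟨?_, union_subset (sdiff_subset.trans hD₁E)
      ((image_mono hX).trans (hbij.image_eq.subset.trans hD₂E))⟩
    convert hb₁ using 1
    ext z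
    have h1 := himg z
    have h2 := hτimg z
    have h3 : z ∈ X → z ∈ D₁ := fun h ↦ hX h
    have h4 : z ∈ X → z ∈ M.E := fun h ↦ hXE h
    simp only [mem_sdiff, mem_union, hB₁def, h1]
    generalize (z ∈ τ '' (X \ D₂)) = p at h2 ⊢
    clear * - h2 h3 h4
    tauto
  · rw [Matroid.dual_isBase_iff']
    refine ⟨?_, union_subset (sdiff_subset.trans hD₂E) hXE⟩
    convert hb₂ using 1
    ext z
    have h1 := himg z
    have h2 := hτimg z
    have h3 : z ∈ X → z ∈ D₁ := fun h ↦ hX h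
    have h4 : z ∈ X → z ∈ M.E := fun h ↦ hXE h
    simp only [mem_sdiff, mem_union, hB₂def, h1]
    generalize (z ∈ τ '' (X \ D₂)) = p at h2 ⊢
    clear * - h2 h3 h4
    tauto

/-- Bases of `M ↾ R` are extended to bases of `M` by a common set, which every ordering fixes. -/
lemma IsBaseOrderable.restrict [M.Finite] (hk : 1 ≤ k) (h : IsBaseOrderable k M) {R : Set α}
    (hR : R ⊆ M.E) : IsBaseOrderable k (M ↾ R) := by
  intro J₁ J₂ hJ₁ hJ₂
  rw [Matroid.isBase_restrict_iff] at hJ₁ hJ₂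
  have hcard : J₁.encard = J₂.encard := by rw [hJ₁.encard_eq_eRk, hJ₂.encard_eq_eRk]
  obtain ⟨B₁, hB₁, hJB₁⟩ := hJ₁.exists_isBase
  have hJ₁B₁ : J₁ ⊆ B₁ := hJB₁ ▸ inter_subset_left
  set K := B₁ \ R with hK
  have hB₁eq : B₁ = J₁ ∪ K := by rw [hJB₁, hK, inter_union_sdiff]
  obtain ⟨B₂, hB₂, hJ₂B₂, hB₂sub⟩ := hJ₂.indep.exists_isBase_subset_union_isBase hB₁
  have hJB₂ : J₂ = B₂ ∩ R :=
    hJ₂.eq_of_subset_indep (hB₂.indep.subset inter_subset_left)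
      (subset_inter hJ₂B₂ hJ₂.subset) inter_subset_right
  have hB₂eq : B₂ = J₂ ∪ K := by
    refine (Finite.subset M.ground_finite ?_).eq_of_subset_of_encard_le ?_ ?_
    · exact hB₂.subset_ground
    · intro z hz
      by_cases hzR : z ∈ R
      · exact .inl (hJB₂ ▸ ⟨hz, hzR⟩)
      · obtain h' | h' := hB₂sub hz
        exacts [.inl h', .inr ⟨h', hzR⟩]
    · rw [hB₂.encard_eq_eRank, ← hB₁.encard_eq_eRank, hB₁eq, encard_union_eq (s := J₁), hcard]
      · exact encard_union_le _ _
      · exact disjoint_sdiff_right.mono_left hJ₁.subset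
  obtain ⟨τ, hτ⟩ := h B₁ B₂ hB₁ hB₂
  have hfix : ∀ x ∈ K, τ x = x := fun x hx ↦
    hτ.eq_of_mem_right hk hx.1 (hB₂eq ▸ .inr hx)
  have hbij : BijOn τ J₁ J₂ := by
    refine ⟨fun x hx ↦ ?_, hτ.1.injOn.mono hJ₁B₁, fun y hy ↦ ?_⟩
    · have h1 := hτ.mapsTo (hJ₁B₁ hx)
      rw [hB₂eq] at h1
      refine h1.resolve_right fun h2 ↦ ?_
      have := hτ.1.injOn (hJ₁B₁ hx) h2.1 (hfix _ h2).symm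
      exact h2.2 (this ▸ hJ₁.subset hx)
    · obtain ⟨x, hx, rfl⟩ := hτ.1.surjOn (hJ₂B₂ hy)
      refine ⟨x, ?_, rfl⟩
      rw [hB₁eq] at hx
      refine hx.resolve_right fun h2 ↦ h2.2 ?_
      rw [← hfix x h2]
      exact hJ₂.subset hy
  have hfin : J₁.Finite := M.ground_finite.subset hJ₁.indep.subset_ground
  have hfin₂ : J₂.Finite := M.ground_finite.subset hJ₂.indep.subset_ground
  refine ⟨τ, hbij, fun X hX hXk ↦ ?_⟩
  have hXB := hX.trans hJ₁B₁
  have hτX : τ '' X ⊆ J₂ := (image_mono hX).trans hbij.image_eq.subset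
  have hXτ : (τ '' X).encard = X.encard := (hbij.injOn.mono hX).encard_image
  obtain ⟨hb₁, hb₂⟩ := hτ.2 X hXB hXk
  have hdisj : Disjoint J₁ K := disjoint_sdiff_right.mono_left hJ₁.subset
  have hdisj₂ : Disjoint J₂ K := disjoint_sdiff_right.mono_left hJ₂.subset
  have base : ∀ S ⊆ R, M.IsBase (S ∪ K) → M.IsBasis S R := by
    intro S hS hSb
    have hSf : S.Finite := M.ground_finite.subset (hS.trans hR)
    have hdS : Disjoint S K := disjoint_sdiff_right.mono_left hS
    refine (Matroid.isBasis_iff_indep_encard_eq_of_finite hSf hR).2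
      ⟨hS, hSb.indep.subset subset_union_left, ?_⟩
    rw [← hJ₁.encard_eq_eRk]
    have h1 := hSb.encard_eq_eRank
    rw [← hB₁.encard_eq_eRank, hB₁eq, encard_union_eq hdisj, encard_union_eq hdS] at h1
    have hKf : K.encard ≠ ⊤ := by
      rw [encard_ne_top_iff]
      exact M.ground_finite.subset (sdiff_subset.trans hB₁.subset_ground)
    exact WithTop.add_right_cancel hKf h1
  rw [Matroid.isBase_restrict_iff hR, Matroid.isBase_restrict_iff hR]
  constructor
  · refine base _ (union_subset (sdiff_subset.trans hJ₁.subset) (hτX.trans hJ₂.subset)) ?_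
    convert hb₁ using 1
    have : K \ X = K := (hdisj.mono_left hX).symm.sdiff_eq_left
    rw [hB₁eq, union_sdiff_distrib, this, union_right_comm]
  · refine base _ (union_subset (sdiff_subset.trans hJ₂.subset) (hX.trans hJ₁.subset)) ?_
    convert hb₂ using 1
    have : K \ (τ '' X) = K := (hdisj₂.mono_left hτX).symm.sdiff_eq_left
    rw [hB₂eq, union_sdiff_distrib, this, union_right_comm]

lemma kBO.dual (hk : 1 ≤ k) (h : kBO k M) : kBO k M✶ := by
  have := h.1
  exact ⟨inferInstance, h.2.dual hk⟩

lemma kBO.restrict (hk : 1 ≤ k) (h : kBO k M) {R : Set α} (hR : R ⊆ M.E) : kBO k (M ↾ R) := by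
  have := h.1
  exact ⟨⟨M.ground_finite.subset hR⟩, h.2.restrict hk hR⟩

lemma kBO.contract (hk : 1 ≤ k) (h : kBO k M) (C : Set α) : kBO k (M ／ C) := by
  rw [← Matroid.dual_delete_dual, Matroid.delete_eq_restrict]
  exact ((h.dual hk).restrict hk sdiff_subset).dual hk

lemma kBO.isMinor (hk : 1 ≤ k) (h : kBO k M) (hN : N ≤m M) : kBO k N := by
  obtain ⟨C, D, rfl⟩ := hN
  rw [Matroid.delete_eq_restrict]
  exact (h.contract hk C).restrict hk sdiff_subset

end MinorDual

/-! ### Direct sums and isomorphisms -/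

section SumIso

variable {α β : Type u} {k : ℕ}

lemma encard_preimage_le_of_injective {f : α → β} (hf : f.Injective) (s : Set β) :
    (f ⁻¹' s).encard ≤ s.encard := by
  rw [← hf.encard_image]
  exact encard_le_encard (image_preimage_subset f s)

lemma kBO.sum {M : Matroid α} {N : Matroid β} (hM : kBO k M) (hN : kBO k N) :
    kBO k (M.sum N) := by
  have := hM.1
  have := hN.1
  refine ⟨⟨?_⟩, fun B₁ B₂ hB₁ hB₂ ↦ ?_⟩
  · rw [Matroid.sum_ground]
    exact (M.ground_finite.image _).union (N.ground_finite.image _)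
  rw [Matroid.sum_isBase_iff] at hB₁ hB₂
  obtain ⟨σ, hσ⟩ := hM.2 _ _ hB₁.1 hB₂.1
  obtain ⟨τ, hτ⟩ := hN.2 _ _ hB₁.2 hB₂.2
  refine ⟨Sum.map σ τ, ⟨?_, ?_, ?_⟩, fun X hX hXk ↦ ?_⟩
  · rintro (x | x) hx
    · exact hσ.mapsTo (show x ∈ Sum.inl ⁻¹' B₁ from hx)
    · exact hτ.mapsTo (show x ∈ Sum.inr ⁻¹' B₁ from hx)
  · rintro (x | x) hx (y | y) hy hxy
    · exact congrArg _ (hσ.1.injOn hx hy (Sum.inl.inj hxy))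
    · cases hxy
    · cases hxy
    · exact congrArg _ (hτ.1.injOn hx hy (Sum.inr.inj hxy))
  · rintro (y | y) hy
    · obtain ⟨x, hx, rfl⟩ := hσ.1.surjOn (show y ∈ Sum.inl ⁻¹' B₂ from hy)
      exact ⟨.inl x, hx, rfl⟩
    · obtain ⟨x, hx, rfl⟩ := hτ.1.surjOn (show y ∈ Sum.inr ⁻¹' B₂ from hy)
      exact ⟨.inr x, hx, rfl⟩
  · have h1 := hσ.2 (Sum.inl ⁻¹' X) (preimage_mono hX)
      ((encard_preimage_le_of_injective Sum.inl_injective X).trans hXk)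
    have h2 := hτ.2 (Sum.inr ⁻¹' X) (preimage_mono hX)
      ((encard_preimage_le_of_injective Sum.inr_injective X).trans hXk)
    have e1 : Sum.inl ⁻¹' (Sum.map σ τ '' X) = σ '' (Sum.inl ⁻¹' X) := by ext; simp
    have e2 : Sum.inr ⁻¹' (Sum.map σ τ '' X) = τ '' (Sum.inr ⁻¹' X) := by ext; simp
    simp only [Matroid.sum_isBase_iff, preimage_union, preimage_sdiff, e1, e2]
    exact ⟨⟨h1.1, h2.1⟩, ⟨h1.2, h2.2⟩⟩

lemma kBO.map {M : Matroid α} (h : kBO k M) (f : α → β) (hf : InjOn f M.E) :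
    kBO k (M.map f hf) := by
  have := h.1
  refine ⟨⟨M.ground_finite.image f⟩, ?_⟩
  intro C₁ C₂ hC₁ hC₂
  rw [Matroid.map_isBase_iff] at hC₁ hC₂
  obtain ⟨B₁, hB₁, rfl⟩ := hC₁
  obtain ⟨B₂, hB₂, rfl⟩ := hC₂
  obtain ⟨σ, hσ⟩ := h.2 B₁ B₂ hB₁ hB₂
  have hB₁E := hB₁.subset_ground
  have hB₂E := hB₂.subset_ground
  obtain hα | hα := isEmpty_or_nonempty α
  · refine ⟨id, ?_⟩
    have : B₁ = B₂ := Subsingleton.elim _ _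
    subst this
    refine ⟨bijOn_id _, fun X hX _ ↦ ?_⟩
    simp only [image_id, sdiff_union_of_subset hX, and_self]
    exact hB₁.map hf
  set g := Function.invFunOn f M.E
  have hgf : ∀ x ∈ M.E, g (f x) = x := fun x hx ↦ hf.leftInvOn_invFunOn hx
  have hval : ∀ x ∈ M.E, (f ∘ σ ∘ g) (f x) = f (σ x) := fun x hx ↦ by simp [hgf x hx]
  refine ⟨f ∘ σ ∘ g, ⟨?_, ?_, ?_⟩, ?_⟩
  · rintro _ ⟨x, hx, rfl⟩
    rw [hval x (hB₁E hx)]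
    exact mem_image_of_mem f (hσ.mapsTo hx)
  · rintro _ ⟨x, hx, rfl⟩ _ ⟨y, hy, rfl⟩ hxy
    rw [hval x (hB₁E hx), hval y (hB₁E hy)] at hxy
    rw [hσ.1.injOn hx hy (hf (hB₂E (hσ.mapsTo hx)) (hB₂E (hσ.mapsTo hy)) hxy)]
  · rintro _ ⟨y, hy, rfl⟩
    obtain ⟨x, hx, rfl⟩ := hσ.1.surjOn hy
    exact ⟨f x, mem_image_of_mem f hx, hval x (hB₁E hx)⟩
  · intro Z hZ hZk
    obtain ⟨X, hX, rfl⟩ := subset_image_iff.1 hZ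
    have hXE := hX.trans hB₁E
    have hσX : σ '' X ⊆ B₂ := (image_mono hX).trans hσ.1.image_eq.subset
    rw [(hf.mono hXE).encard_image] at hZk
    obtain ⟨h1, h2⟩ := hσ.2 X hX hZk
    have e0 : (f ∘ σ ∘ g) '' (f '' X) = f '' (σ '' X) := by
      rw [image_image, image_image]
      exact image_congr fun x hx ↦ hval x (hXE hx)
    rw [e0, ← (hf.mono hB₁E).image_sdiff_subset hX, ← (hf.mono hB₂E).image_sdiff_subset hσX,
      ← image_union, ← image_union]
    exact ⟨h1.map hf, h2.map hf⟩

lemma kBO_of_ground_eq_empty {M : Matroid α} (h : M.E = ∅) : kBO k M := by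
  refine ⟨⟨by simp [h]⟩, fun B₁ B₂ hB₁ hB₂ ↦ ⟨id, ?_⟩⟩
  obtain rfl : B₁ = ∅ := subset_empty_iff.1 (h ▸ hB₁.subset_ground)
  obtain rfl : B₂ = ∅ := subset_empty_iff.1 (h ▸ hB₂.subset_ground)
  refine ⟨bijOn_id _, fun X hX _ ↦ ?_⟩
  obtain rfl := subset_empty_iff.1 hX
  simpa using hB₁

lemma IsIsomorphic.exists_eq_map {M : Matroid α} {N : Matroid β} (h : IsIsomorphic M N)
    (hne : N.E.Nonempty) : ∃ (f : α → β) (hf : InjOn f M.E), N = M.map f hf := by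
  classical
  obtain ⟨φ, hφ⟩ := h
  obtain ⟨b, hb⟩ := hne
  set f : α → β := fun x ↦ if hx : x ∈ M.E then φ ⟨x, hx⟩ else b with hfdef
  have hfval : ∀ x : M.E, f x = φ x := fun x ↦ by simp [hfdef]
  have hf : InjOn f M.E := by
    intro x hx y hy hxy
    have h1 := hfval ⟨x, hx⟩
    have h2 := hfval ⟨y, hy⟩
    simp only at h1 h2
    rw [h1, h2] at hxy
    simpa using φ.injective (Subtype.ext hxy)
  have himg : ∀ I : Set M.E, f '' (Subtype.val '' I) = Subtype.val '' (φ '' I) := by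
    intro I
    rw [image_image, image_image]
    exact image_congr fun x _ ↦ hfval x
  refine ⟨f, hf, Matroid.ext_indep ?_ ?_⟩
  · have := himg univ
    rw [image_univ, image_univ, φ.surjective.range_eq, image_univ, Subtype.range_val,
      Subtype.range_val] at this
    exact this.symm
  · intro I hI
    rw [Matroid.map_indep_iff]
    obtain ⟨J, rfl⟩ : ∃ J : Set N.E, I = Subtype.val '' J :=
      ⟨Subtype.val ⁻¹' I, by simp [inter_eq_self_of_subset_right hI]⟩
    obtain ⟨J, rfl⟩ : ∃ J' : Set M.E, J = φ '' J' := ⟨φ ⁻¹' J, by simp [φ.surjective]⟩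
    constructor
    · exact fun h ↦ ⟨_, (hφ J).2 h, (himg J).symm⟩
    · rintro ⟨I₀, hI₀, h0⟩
      rw [← himg J] at h0
      rw [hf.image_eq_image_iff (by simp) hI₀.subset_ground] at h0
      rw [← hφ, h0]
      exact hI₀

lemma kBO.of_isIsomorphic {M : Matroid α} {N : Matroid β} (h : kBO k M) (hMN : IsIsomorphic M N) :
    kBO k N := by
  obtain hN | hN := N.E.eq_empty_or_nonempty
  · exact kBO_of_ground_eq_empty hN
  · obtain ⟨f, hf, rfl⟩ := hMN.exists_eq_map hN
    exact h.map f hf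

lemma kBO.of_mapEmbedding {M : Matroid α} (f : α ↪ β) (h : kBO k (M.mapEmbedding f)) :
    kBO k M := by
  obtain hα | hα := isEmpty_or_nonempty α
  · exact kBO_of_ground_eq_empty (eq_empty_of_isEmpty _)
  have hinv := Function.leftInverse_invFun f.injective
  have hinj : InjOn (Function.invFun f) (M.mapEmbedding f).E := by
    rintro _ ⟨x, -, rfl⟩ _ ⟨y, -, rfl⟩ hxy
    rw [hinv x, hinv y] at hxy
    rw [hxy]
  have himg : ∀ I : Set α, Function.invFun f '' (f '' I) = I := fun I ↦ hinv.image_image I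
  convert h.map (Function.invFun f) hinj
  refine Matroid.ext_indep ?_ fun I hI ↦ ?_
  · exact (himg M.E).symm
  · rw [Matroid.map_indep_iff]
    refine ⟨fun h ↦ ⟨f '' I, h.mapEmbedding f, (himg I).symm⟩, ?_⟩
    rintro ⟨_, ⟨J, hJ, rfl⟩, rfl⟩
    rwa [himg J]

end SumIso

/-! ### Principal extensions -/

section PrincipalExtension

variable {α : Type u} {M : Matroid α} {Y : Set α} {e : α} {k : ℕ}

lemma exists_insert_indep_of_ncard_lt [M.Finite] {I J : Set α} (hI : M.Indep I) (hJ : M.Indep J)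
    (h : I.ncard < J.ncard) : ∃ z ∈ J, z ∉ I ∧ M.Indep (insert z I) := by
  obtain ⟨z, hz, hzI⟩ := hI.exists_insert_of_encard_lt hJ (by
    rw [← (M.ground_finite.subset hI.subset_ground).cast_ncard_eq,
      ← (M.ground_finite.subset hJ.subset_ground).cast_ncard_eq]
    exact_mod_cast h)
  exact ⟨z, hz.1, hz.2, hzI⟩

/-- Independence in the principal extension `M +_Y e`: an independent set containing `e` is one in
which `e` can be replaced by a new element of `Y`. -/
def PrincIndep (M : Matroid α) (Y : Set α) (e : α) (I : Set α) : Prop :=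
  (e ∉ I ∧ M.Indep I) ∨ (e ∈ I ∧ ∃ y ∈ Y, y ∉ I ∧ M.Indep (insert y (I \ {e})))

lemma princIndep_of_notMem {I : Set α} (h : e ∉ I) : PrincIndep M Y e I ↔ M.Indep I := by
  simp [PrincIndep, h]

lemma princIndep_insert (he : e ∉ M.E) {I : Set α} (h : e ∉ I) :
    PrincIndep M Y e (insert e I) ↔ ∃ y ∈ Y, y ∉ I ∧ M.Indep (insert y I) := by
  simp only [PrincIndep, mem_insert_iff, true_or, not_true_eq_false, false_and, true_and, false_or,
    insert_sdiff_self_of_notMem h, not_or]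
  refine exists_congr fun y ↦ and_congr_right fun _ ↦ ⟨fun h ↦ ⟨h.1.2, h.2⟩,
    fun h' ↦ ⟨⟨?_, h'.1⟩, h'.2⟩⟩
  rintro rfl
  exact he (h'.2.subset_ground (mem_insert _ _))

lemma PrincIndep.subset {I J : Set α} (hJ : PrincIndep M Y e J) (hIJ : I ⊆ J) :
    PrincIndep M Y e I := by
  obtain ⟨h, hJ⟩ | ⟨h, y, hy, hyJ, hJ⟩ := hJ
  · exact .inl ⟨fun h' ↦ h (hIJ h'), hJ.subset hIJ⟩
  · by_cases heI : e ∈ I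
    · exact .inr ⟨heI, y, hy, fun h' ↦ hyJ (hIJ h'),
        hJ.subset (insert_subset_insert (sdiff_subset_sdiff_left hIJ))⟩
    · refine .inl ⟨heI, hJ.subset fun x hx ↦ .inr ⟨hIJ hx, ?_⟩⟩
      rintro rfl
      exact heI hx

lemma PrincIndep.augment [M.Finite] (he : e ∉ M.E) {I J : Set α} (hI : PrincIndep M Y e I)
    (hJ : PrincIndep M Y e J) (hIJ : I.ncard < J.ncard) :
    ∃ z ∈ J, z ∉ I ∧ PrincIndep M Y e (insert z I) := by
  have hfin : ∀ {K}, M.Indep K → K.Finite := fun h ↦ M.ground_finite.subset h.subset_ground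
  have heE : ∀ {K}, M.Indep K → e ∉ K := fun h h' ↦ he (h.subset_ground h')
  by_cases heI : e ∈ I
  · obtain ⟨I, rfl, heI'⟩ : ∃ I', I = insert e I' ∧ e ∉ I' := ⟨I \ {e}, by simp [heI], by simp⟩
    obtain ⟨y₁, hy₁, hy₁I, hI⟩ := (princIndep_insert he heI').1 hI
    have hIf : I.Finite := (hfin hI).subset (subset_insert _ _)
    rw [ncard_insert_of_notMem heI' hIf] at hIJ
    have hc₁ := ncard_insert_of_notMem hy₁I hIf
    by_cases heJ : e ∈ J
    · obtain ⟨J, rfl, heJ'⟩ : ∃ J', J = insert e J' ∧ e ∉ J' := ⟨J \ {e}, by simp [heJ], by simp⟩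
      obtain ⟨y₂, hy₂, hy₂J, hJ⟩ := (princIndep_insert he heJ').1 hJ
      have hJf : J.Finite := (hfin hJ).subset (subset_insert _ _)
      rw [ncard_insert_of_notMem heJ' hJf] at hIJ
      have hc₂ := ncard_insert_of_notMem hy₂J hJf
      -- It is enough to find `z ∈ J \ I` and `y ∈ Y` such that `I ∪ {z, y}` is independent.
      have fin : ∀ z ∈ J, z ∉ I → ∀ y ∈ Y, y ∉ insert z I → M.Indep (insert y (insert z I)) →
          ∃ z ∈ insert e J, z ∉ insert e I ∧ PrincIndep M Y e (insert z (insert e I)) := by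
        intro z hz hzI y hy hyI h
        have hze : z ≠ e := by rintro rfl; exact heJ' hz
        refine ⟨z, .inr hz, by simp [hze, hzI], ?_⟩
        rw [insert_comm, princIndep_insert he (by simp [hze.symm, heI'])]
        exact ⟨y, hy, hyI, h⟩
      obtain ⟨z, hzJ, hzI, hz⟩ := exists_insert_indep_of_ncard_lt hI hJ (by omega)
      obtain ⟨hzy, hzI'⟩ := not_or.1 hzI
      obtain rfl | hzJ := hzJ
      · obtain ⟨w, hwJ, hwI, hw⟩ := exists_insert_indep_of_ncard_lt
          (hI.subset (subset_insert _ _)) (hJ.subset (subset_insert _ _)) (by omega)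
        have hc₃ := ncard_insert_of_notMem hwI hIf
        have hc₄ := ncard_insert_of_notMem hzI (hfin hI)
        obtain ⟨y, hy, hyI, h⟩ := exists_insert_indep_of_ncard_lt hw hz (by omega)
        refine fin w hwJ hwI y ?_ hyI h
        obtain rfl | rfl | hy := hy
        exacts [hy₂, hy₁, absurd (mem_insert_of_mem w hy) hyI]
      · refine fin z hzJ hzI' y₁ hy₁ (by simpa [hy₁I] using fun h ↦ hzy h.symm) ?_
        rwa [insert_comm]
    · rw [princIndep_of_notMem heJ] at hJ
      obtain ⟨z, hzJ, hzI, hz⟩ := exists_insert_indep_of_ncard_lt hI hJ (by omega)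
      obtain ⟨hzy, hzI'⟩ := not_or.1 hzI
      have hze : z ≠ e := by rintro rfl; exact heJ hzJ
      refine ⟨z, hzJ, by simp [hze, hzI'], ?_⟩
      rw [insert_comm, princIndep_insert he (by simp [hze.symm, heI'])]
      exact ⟨y₁, hy₁, by simpa [hy₁I] using fun h ↦ hzy h.symm, by rwa [insert_comm]⟩
  · have hI' := (princIndep_of_notMem heI).1 hI
    have key : ∀ z, z ∉ I → M.Indep (insert z I) → PrincIndep M Y e (insert z I) :=
      fun z _ hz ↦ (princIndep_of_notMem (heE hz)).2 hz
    by_cases heJ : e ∈ J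
    · obtain ⟨J, rfl, heJ'⟩ : ∃ J', J = insert e J' ∧ e ∉ J' := ⟨J \ {e}, by simp [heJ], by simp⟩
      obtain ⟨y, hy, hyJ, hJ⟩ := (princIndep_insert he heJ').1 hJ
      have hJf : J.Finite := (hfin hJ).subset (subset_insert _ _)
      rw [ncard_insert_of_notMem heJ' hJf, ← ncard_insert_of_notMem hyJ hJf] at hIJ
      obtain ⟨z, hzJ, hzI, hz⟩ := exists_insert_indep_of_ncard_lt hI' hJ hIJ
      obtain rfl | hzJ := hzJ
      · exact ⟨e, mem_insert _ _, heI, (princIndep_insert he heI).2 ⟨z, hy, hzI, hz⟩⟩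
      · exact ⟨z, .inr hzJ, hzI, key z hzI hz⟩
    · rw [princIndep_of_notMem heJ] at hJ
      obtain ⟨z, hzJ, hzI, hz⟩ := exists_insert_indep_of_ncard_lt hI' hJ hIJ
      exact ⟨z, hzJ, hzI, key z hzI hz⟩

/-- The principal extension `M +_Y e`, for `e ∉ M.E`. Elements of `Y` outside `M.E` are ignored. -/
def princExt (M : Matroid α) [M.Finite] (Y : Set α) (e : α) (he : e ∉ M.E) : Matroid α :=
  (IndepMatroid.ofFinite (E := insert e M.E) (M.ground_finite.insert e) (PrincIndep M Y e)
    ((princIndep_of_notMem (notMem_empty e)).2 M.empty_indep)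
    (fun _ _ hJ hIJ ↦ hJ.subset hIJ) (fun _ _ hI hJ hIJ ↦ hI.augment he hJ hIJ) (by
      rintro I (⟨-, hI⟩ | ⟨-, y, -, -, hI⟩)
      · exact hI.subset_ground.trans (subset_insert _ _)
      · intro x hx
        by_cases hxe : x = e
        · exact .inl hxe
        · exact .inr (hI.subset_ground (.inr ⟨hx, hxe⟩)))).matroid

lemma exists_insert_isBase_of_subset {c y₁ y₂ : α} {S D : Set α} (hc : c ∉ S)
    (hS : M.IsBase (insert c S)) (hD : M.IsBase D) (hDS : D ⊆ insert y₁ (insert y₂ S))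
    (hy₁ : y₁ ∈ Y) (hy₂ : y₂ ∈ Y) : ∃ y ∈ Y, y ∉ S ∧ M.IsBase (insert y S) := by
  have hY : ∀ z ∈ D, z ∉ S → z ∈ Y := by
    intro z hz hzS
    obtain rfl | rfl | h := hDS hz
    exacts [hy₁, hy₂, absurd h hzS]
  by_cases hcD : c ∈ D
  · exact ⟨c, hY c hcD hc, hc, hS⟩
  · obtain ⟨b, hb, hbS⟩ := hS.exchange hD ⟨mem_insert _ _, hcD⟩
    rw [insert_sdiff_self_of_notMem hc] at hbS
    have hb' : b ∉ S := fun h ↦ hb.2 (.inr h)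
    exact ⟨b, hY b hb.1 hb', hb', hbS⟩

variable [M.Finite] {he : e ∉ M.E}

@[simp] lemma princExt_ground : (princExt M Y e he).E = insert e M.E := rfl

instance princExt_finite : (princExt M Y e he).Finite := ⟨M.ground_finite.insert e⟩

lemma princExt_indep_iff {I : Set α} (h : e ∉ I) : (princExt M Y e he).Indep I ↔ M.Indep I :=
  princIndep_of_notMem h

lemma princExt_insert_indep_iff {I : Set α} (h : e ∉ I) :
    (princExt M Y e he).Indep (insert e I) ↔ ∃ y ∈ Y, y ∉ I ∧ M.Indep (insert y I) :=
  princIndep_insert he h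

lemma isBase_iff_indep_encard_eq {N : Matroid α} [N.Finite] {B : Set α} :
    N.IsBase B ↔ N.Indep B ∧ B.encard = N.eRank := by
  refine ⟨fun h ↦ ⟨h.indep, h.encard_eq_eRank⟩, fun ⟨h, hc⟩ ↦ ?_⟩
  rw [← Matroid.isBasis_ground_iff, Matroid.isBasis_iff_indep_encard_eq_of_finite
    (N.ground_finite.subset h.subset_ground), Matroid.eRk_ground]
  exact ⟨h.subset_ground, h, hc⟩

/-- An independent set of the extension has the cardinality of an independent set of `M`. -/
lemma exists_indep_of_princExt_indep {I : Set α} (hI : (princExt M Y e he).Indep I) :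
    ∃ J ⊆ (I \ {e}) ∪ Y, M.Indep J ∧ J.encard = I.encard := by
  by_cases heI : e ∈ I
  · obtain ⟨I, rfl, heI'⟩ : ∃ I', I = insert e I' ∧ e ∉ I' := ⟨I \ {e}, by simp [heI], by simp⟩
    obtain ⟨y, hy, hyI, hI⟩ := (princExt_insert_indep_iff heI').1 hI
    refine ⟨insert y I, ?_, hI, by rw [encard_insert_of_notMem hyI, encard_insert_of_notMem heI']⟩
    rw [insert_sdiff_self_of_notMem heI']
    exact insert_subset (.inr hy) subset_union_left
  · exact ⟨I, by simp [heI], (princExt_indep_iff heI).1 hI, rfl⟩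

lemma princExt_eRank : (princExt M Y e he).eRank = M.eRank := by
  apply le_antisymm
  · obtain ⟨B, hB⟩ := (princExt M Y e he).exists_isBase
    obtain ⟨J, -, hJ, hc⟩ := exists_indep_of_princExt_indep hB.indep
    rw [← hB.encard_eq_eRank, ← hc]
    exact hJ.encard_le_eRank
  · obtain ⟨B, hB⟩ := M.exists_isBase
    rw [← hB.encard_eq_eRank]
    exact ((princExt_indep_iff fun h ↦ he (hB.subset_ground h)).2 hB.indep).encard_le_eRank

lemma princExt_isBase_iff {B : Set α} (h : e ∉ B) :
    (princExt M Y e he).IsBase B ↔ M.IsBase B := by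
  rw [isBase_iff_indep_encard_eq, isBase_iff_indep_encard_eq, princExt_indep_iff h, princExt_eRank]

lemma princExt_insert_isBase_iff {B : Set α} (h : e ∉ B) :
    (princExt M Y e he).IsBase (insert e B) ↔ ∃ y ∈ Y, y ∉ B ∧ M.IsBase (insert y B) := by
  simp_rw [isBase_iff_indep_encard_eq]
  rw [princExt_insert_indep_iff h, princExt_eRank, encard_insert_of_notMem h]
  constructor
  · rintro ⟨⟨y, hy, hyB, hI⟩, hc⟩
    exact ⟨y, hy, hyB, hI, by rwa [encard_insert_of_notMem hyB]⟩
  · rintro ⟨y, hy, hyB, hI, hc⟩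
    exact ⟨⟨y, hy, hyB, hI⟩, by rwa [encard_insert_of_notMem hyB] at hc⟩

lemma princExt_eRk {X : Set α} (hX : X ⊆ M.E) : (princExt M Y e he).eRk X = M.eRk X := by
  have heX : ∀ {I}, I ⊆ X → e ∉ I := fun hI h ↦ he (hX (hI h))
  apply le_antisymm
  · rw [Matroid.eRk_le_iff]
    exact fun I hIX hI ↦ ((princExt_indep_iff (heX hIX)).1 hI).encard_le_eRk_of_subset hIX
  · rw [Matroid.eRk_le_iff]
    exact fun I hIX hI ↦
      ((princExt_indep_iff (he := he) (heX hIX)).2 hI).encard_le_eRk_of_subset hIX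

lemma princExt_eRk_insert {X : Set α} (hX : X ⊆ M.E) :
    (princExt M Y e he).eRk (insert e X) = min (M.eRk X + 1) (M.eRk (X ∪ Y)) := by
  apply le_antisymm
  · refine le_min ?_ ?_
    · rw [← princExt_eRk (he := he) hX]
      exact Matroid.eRk_insert_le_add_one _ _ _
    · rw [Matroid.eRk_le_iff]
      intro I hIX hI
      obtain ⟨J, hJI, hJ, hc⟩ := exists_indep_of_princExt_indep hI
      rw [← hc]
      refine hJ.encard_le_eRk_of_subset (hJI.trans (union_subset_union_left Y ?_))
      exact fun x hx ↦ (hIX hx.1).resolve_left hx.2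
  · obtain hle | hlt := le_or_gt (M.eRk (X ∪ Y)) (M.eRk X)
    · exact (min_le_right _ _).trans (hle.trans (by
        rw [← princExt_eRk (he := he) hX]
        exact Matroid.eRk_mono _ (subset_insert _ _)))
    · refine (min_le_left _ _).trans ?_
      obtain ⟨I, hI⟩ := M.exists_isBasis X
      obtain ⟨J, hJ⟩ := M.exists_isBasis' (X ∪ Y)
      rw [← hI.encard_eq_eRk, ← hJ.encard_eq_eRk] at hlt
      obtain ⟨y, ⟨hyJ, hyI⟩, hy⟩ := hI.indep.exists_insert_of_encard_lt hJ.indep hlt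
      have hyY : y ∈ Y := by
        refine (hJ.subset hyJ).resolve_left fun hyX ↦ hyI ?_
        rw [hI.eq_of_subset_indep hy (subset_insert _ _) (insert_subset hyX hI.subset)]
        exact mem_insert _ _
      have heI : e ∉ I := fun h ↦ he (hX (hI.subset h))
      have hind := (princExt_insert_indep_iff (he := he) heI).2 ⟨y, hyY, hyI, hy⟩
      rw [← hI.encard_eq_eRk, ← encard_insert_of_notMem heI]
      exact hind.encard_le_eRk_of_subset (insert_subset_insert hI.subset)

lemma isPrincipalExtension_princExt (hY : Y ⊆ M.E) :
    IsPrincipalExtension M Y e (princExt M Y e he) :=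
  ⟨hY, he, rfl, fun _ hX ↦ princExt_eRk hX, fun _ hX ↦ princExt_eRk_insert hX⟩

/-- The rank conditions determine the principal extension. -/
lemma IsPrincipalExtension.eq_princExt {N : Matroid α} (h : IsPrincipalExtension M Y e N) :
    N = princExt M Y e h.notMem_ground := by
  refine Matroid.ext_indep h.ground_eq fun I hI ↦ ?_
  rw [h.ground_eq] at hI
  have hfin : I.Finite := (M.ground_finite.insert e).subset hI
  rw [Matroid.indep_iff_eRk_eq_encard_of_finite hfin, Matroid.indep_iff_eRk_eq_encard_of_finite hfin]
  suffices N.eRk I = (princExt M Y e h.notMem_ground).eRk I by rw [this]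
  by_cases heI : e ∈ I
  · obtain ⟨I, rfl, heI'⟩ : ∃ I', I = insert e I' ∧ e ∉ I' := ⟨I \ {e}, by simp [heI], by simp⟩
    have hIE : I ⊆ M.E := (insert_subset_insert_iff heI').1 hI
    rw [h.rank_insert_eq I hIE, princExt_eRk_insert hIE]
  · have hIE : I ⊆ M.E := (subset_insert_iff_of_notMem heI).1 hI
    rw [h.rank_eq I hIE, princExt_eRk hIE]

/-- The case of the ordering theorem for `M +_Y e` in which only the second base contains `e`: the
element `y ∈ Y` that `e` replaces is replaced by `e` in the ordering. -/
lemma exists_isExchangeOrdering_insert_right (hk : 1 ≤ k) {B C : Set α} {y : α} {τ : α → α}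
    (hy : y ∈ Y) (hyC : y ∉ C) (hτ : IsExchangeOrdering M k B (insert y C) τ) :
    ∃ σ, IsExchangeOrdering (princExt M Y e he) k B (insert e C) σ := by
  classical
  have heB : e ∉ B := fun h ↦ he (hτ.isBase_left.subset_ground h)
  have heC' : e ∉ insert y C := fun h ↦ he (hτ.isBase_right.subset_ground h)
  have heC : e ∉ C := fun h ↦ heC' (.inr h)
  have hye : y ≠ e := fun h ↦ heC' (.inl h.symm)
  have hmaps := hτ.1.mapsTo
  have hinj := hτ.1.injOn
  have hfix : y ∈ B → τ y = y := fun h ↦ hτ.eq_of_mem_right hk h (mem_insert _ _)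
  set σ : α → α := fun x ↦ if τ x = y then e else τ x with hσ
  have h1 : ∀ x, τ x = y → σ x = e := fun x hx ↦ by simp [hσ, hx]
  have h2 : ∀ x, τ x ≠ y → σ x = τ x := fun x hx ↦ by simp [hσ, hx]
  have heτ : ∀ x ∈ B, τ x ≠ e := fun x hx h ↦ heC' (h ▸ hmaps hx)
  refine ⟨σ, ⟨fun x hx ↦ ?_, fun x hx x' hx' hxx ↦ ?_, fun z hz ↦ ?_⟩, fun X hX hXk ↦ ?_⟩
  · by_cases hxy : τ x = y
    · rw [h1 x hxy]; exact mem_insert _ _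
    · rw [h2 x hxy]; exact .inr ((hmaps hx).resolve_left hxy)
  · by_cases hxy : τ x = y <;> by_cases hxy' : τ x' = y
    · exact hinj hx hx' (hxy.trans hxy'.symm)
    · rw [h1 x hxy, h2 x' hxy'] at hxx
      exact absurd hxx.symm (heτ x' hx')
    · rw [h2 x hxy, h1 x' hxy'] at hxx
      exact absurd hxx (heτ x hx)
    · rw [h2 x hxy, h2 x' hxy'] at hxx
      exact hinj hx hx' hxx
  · obtain rfl | hz := hz
    · obtain ⟨x, hx, hxy⟩ := hτ.1.surjOn (mem_insert y C)
      exact ⟨x, hx, h1 x hxy⟩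
    · obtain ⟨x, hx, rfl⟩ := hτ.1.surjOn (mem_insert_of_mem y hz)
      refine ⟨x, hx, h2 x ?_⟩
      rintro hxy
      exact hyC (hxy ▸ hz)
  · obtain ⟨hb₁, hb₂⟩ := hτ.2 X hX hXk
    have heX : e ∉ X := fun h ↦ heB (hX h)
    have heτX : e ∉ τ '' X := by rintro ⟨x, hx, h⟩; exact heτ x (hX hx) h
    by_cases hyX : y ∈ τ '' X
    · have himg : σ '' X = insert e (τ '' X \ {y}) := by
        obtain ⟨a, ha, hay⟩ := hyX
        ext z
        constructor
        · rintro ⟨x, hx, rfl⟩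
          by_cases hxy : τ x = y
          · rw [h1 x hxy]; exact mem_insert _ _
          · rw [h2 x hxy]; exact .inr ⟨⟨x, hx, rfl⟩, hxy⟩
        · rintro (rfl | ⟨⟨x, hx, rfl⟩, hxy⟩)
          · exact ⟨a, ha, h1 a hay⟩
          · exact ⟨x, hx, h2 x hxy⟩
      have hyBX : y ∉ B \ X := by
        rintro ⟨hyB, hyX'⟩
        obtain ⟨a, ha, hay⟩ := hyX
        have := hinj (hX ha) hyB (hay.trans (hfix hyB).symm)
        exact hyX' (this ▸ ha)
      rw [himg]
      generalize τ '' X = T at *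
      constructor
      · rw [union_insert, princExt_insert_isBase_iff (by simp [heB, heτX])]
        refine ⟨y, hy, by simp [mem_union, hyBX], ?_⟩
        convert hb₁ using 1
        grind
      · rw [show insert e C \ insert e (T \ {y}) ∪ X = insert y C \ T ∪ X by grind,
          princExt_isBase_iff (by simp [heC, heX, hye.symm])]
        exact hb₂
    · have himg : σ '' X = τ '' X := image_congr fun x hx ↦ h2 x fun hxy ↦ hyX ⟨x, hx, hxy⟩
      have hyX' : y ∉ X := fun h ↦ hyX ⟨y, h, hfix (hX h)⟩
      rw [himg]
      generalize τ '' X = T at *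
      constructor
      · rwa [princExt_isBase_iff (by simp [heB, heτX])]
      · rw [show insert e C \ T ∪ X = insert e (C \ T ∪ X) by grind,
          princExt_insert_isBase_iff (by simp [heC, heX])]
        refine ⟨y, hy, by simp [hyC, hyX'], ?_⟩
        convert hb₂ using 1
        grind

/-- The case of the ordering theorem for `M +_Y e` in which both bases contain `e`. Let `τ` be an
ordering for the bases in which `e` has been replaced by `y₁` and by `y₂`, respectively. If
`τ c = y₂` with `c ≠ y₁`, then `c` is sent to `τ y₁` instead; when `c` belongs to the exchanged set,
base exchange shows that `y₁` or `y₂` may take the place of `e`. -/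
lemma exists_isExchangeOrdering_insert_insert (hk : 1 ≤ k) {C₁ C₂ : Set α} {y₁ y₂ : α} {τ : α → α}
    (hy₁ : y₁ ∈ Y) (hy₂ : y₂ ∈ Y) (hyC₁ : y₁ ∉ C₁) (hyC₂ : y₂ ∉ C₂)
    (hτ : IsExchangeOrdering M k (insert y₁ C₁) (insert y₂ C₂) τ) :
    ∃ σ, IsExchangeOrdering (princExt M Y e he) k (insert e C₁) (insert e C₂) σ := by
  classical
  have heC₁ : e ∉ C₁ := fun h ↦ he (hτ.isBase_left.subset_ground (.inr h))
  have heC₂ : e ∉ C₂ := fun h ↦ he (hτ.isBase_right.subset_ground (.inr h))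
  have hmaps := hτ.1.mapsTo
  have hinj := hτ.1.injOn
  have hmem₁ : y₁ ∈ insert y₁ C₁ := mem_insert _ _
  set σ : α → α := fun x ↦ if x = e then e else if τ x = y₂ then τ y₁ else τ x with hσ
  have hσe : σ e = e := by simp [hσ]
  have h1 : ∀ x ∈ C₁, τ x = y₂ → σ x = τ y₁ := fun x hx hxy ↦ by
    simp [hσ, hxy, ne_of_mem_of_not_mem hx heC₁]
  have h2 : ∀ x ∈ C₁, τ x ≠ y₂ → σ x = τ x := fun x hx hxy ↦ by
    simp [hσ, hxy, ne_of_mem_of_not_mem hx heC₁]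
  have hne : ∀ x ∈ C₁, τ x ≠ τ y₁ := fun x hx h ↦ hyC₁ (hinj (.inr hx) hmem₁ h ▸ hx)
  have hbij : BijOn σ C₁ C₂ := by
    refine ⟨fun x hx ↦ ?_, fun x hx x' hx' hxx ↦ ?_, fun z hz ↦ ?_⟩
    · by_cases hxy : τ x = y₂
      · rw [h1 x hx hxy]
        exact (hmaps hmem₁).resolve_left fun h ↦ hne x hx (hxy.trans h.symm)
      · rw [h2 x hx hxy]
        exact (hmaps (mem_insert_of_mem _ hx)).resolve_left hxy
    · by_cases hxy : τ x = y₂ <;> by_cases hxy' : τ x' = y₂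
      · exact hinj (.inr hx) (.inr hx') (hxy.trans hxy'.symm)
      · rw [h1 x hx hxy, h2 x' hx' hxy'] at hxx
        exact absurd hxx.symm (hne x' hx')
      · rw [h2 x hx hxy, h1 x' hx' hxy'] at hxx
        exact absurd hxx (hne x hx)
      · rw [h2 x hx hxy, h2 x' hx' hxy'] at hxx
        exact hinj (.inr hx) (.inr hx') hxx
    · have hzy : z ≠ y₂ := ne_of_mem_of_not_mem hz hyC₂
      obtain ⟨x, rfl | hx, rfl⟩ := hτ.1.surjOn (mem_insert_of_mem y₂ hz)
      · obtain ⟨c, rfl | hc, hcy⟩ := hτ.1.surjOn (mem_insert y₂ C₂)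
        · exact absurd hcy hzy
        · exact ⟨c, hc, h1 c hc hcy⟩
      · exact ⟨x, hx, h2 x hx hzy⟩
  have hbij' : BijOn σ (insert e C₁) (insert e C₂) := by
    have := hbij.insert (a := e) (by rwa [hσe])
    rwa [hσe] at this
  refine ⟨σ, isExchangeOrdering_of_fixed hbij' (mem_insert _ _) (mem_insert _ _) hσe ?_⟩
  intro X hX heX hXk
  have hXC : X ⊆ C₁ := (subset_insert_iff_of_notMem heX).1 hX
  have heσX : e ∉ σ '' X := fun h ↦ heC₂ (hbij.mapsTo.image_subset (image_mono hXC h))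
  rw [insert_sdiff_of_notMem _ heX, insert_sdiff_of_notMem _ heσX, insert_union, insert_union,
    princExt_insert_isBase_iff (by simp only [mem_union, mem_sdiff]; tauto),
    princExt_insert_isBase_iff (by simp only [mem_union, mem_sdiff]; tauto)]
  have hy₁X : y₁ ∉ X := fun h ↦ hyC₁ (hXC h)
  obtain ⟨hb₁, hb₂⟩ := hτ.2 X (hXC.trans (subset_insert _ _)) hXk
  by_cases hyX : y₂ ∈ τ '' X
  · obtain ⟨c, hcX, hcy⟩ := hyX
    have hc := hXC hcX
    obtain ⟨X, rfl, hcX₀⟩ : ∃ X₀, X = insert c X₀ ∧ c ∉ X₀ := ⟨X \ {c}, by simp [hcX], by simp⟩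
    have hX₀ : X ⊆ C₁ := (subset_insert _ _).trans hXC
    have hcX₀y : y₂ ∉ τ '' X := by
      rintro ⟨x, hx, hxy⟩
      exact hcX₀ (hinj (.inr (hX₀ hx)) (.inr hc) (hxy.trans hcy.symm) ▸ hx)
    have hy₁X₀ : y₁ ∉ X := fun h ↦ hy₁X (.inr h)
    have himg : σ '' insert c X = insert (τ y₁) (τ '' X) := by
      rw [image_insert_eq, h1 c hc hcy]
      exact congrArg _ (image_congr fun x hx ↦ h2 x (hX₀ hx) fun h ↦ hcX₀y ⟨x, hx, h⟩)
    have hdC₂ : τ y₁ ∈ C₂ :=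
      (hmaps hmem₁).resolve_left fun h ↦ hne c hc (hcy.trans h.symm)
    obtain ⟨hb₁', hb₂'⟩ := hτ.2 (insert y₁ X) (insert_subset_insert hX₀) (by
      rwa [encard_insert_of_notMem hy₁X₀, ← encard_insert_of_notMem hcX₀])
    have hcd : c ≠ τ y₁ := by
      intro h
      have := hτ.eq_of_mem_left hk hmem₁ (h ▸ mem_insert_of_mem _ hc)
      exact hyC₁ (this ▸ h ▸ hc)
    have hcτ : c ∉ τ '' X := by
      rintro ⟨x, hx, hxc⟩
      have := hτ.eq_of_mem_left hk (.inr (hX₀ hx)) (hxc ▸ mem_insert_of_mem _ hc)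
      exact hcX₀ (this.symm.trans hxc ▸ hx)
    have hdτ : τ y₁ ∉ τ '' X := by
      rintro ⟨x, hx, hxd⟩
      exact hne x (hX₀ hx) hxd
    have hdX : τ y₁ ∉ X := by
      intro h
      have := hτ.eq_of_mem_right hk (mem_insert_of_mem _ (hX₀ h)) (mem_insert_of_mem _ hdC₂)
      exact hne _ (hX₀ h) this
    rw [himg]
    rw [image_insert_eq, hcy] at hb₁ hb₂
    rw [image_insert_eq] at hb₁' hb₂'
    generalize τ '' X = T at *
    generalize τ y₁ = d at *
    constructor
    · refine exists_insert_isBase_of_subset (c := c) (D := insert y₁ C₁ \ insert c X ∪ insert y₂ T)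
        ?_ ?_ hb₁ ?_ hy₁ hy₂
      · grind
      · convert hb₁' using 1
        grind
      · grind
    · refine exists_insert_isBase_of_subset (c := d)
        (D := insert y₂ C₂ \ insert d T ∪ insert y₁ X) ?_ ?_ hb₂' ?_ hy₁ hy₂
      · grind
      · convert hb₂ using 1
        grind
      · grind
  · have himg : σ '' X = τ '' X := image_congr fun x hx ↦
      h2 x (hXC hx) fun hxy ↦ hyX ⟨x, hx, hxy⟩
    have hy₁τ : y₁ ∉ τ '' X := by
      rintro ⟨x, hx, hxy⟩
      have := hτ.eq_of_mem_left hk (.inr (hXC hx)) (hxy ▸ hmem₁)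
      exact hy₁X (this.symm.trans hxy ▸ hx)
    have hy₂X : y₂ ∉ X := fun h ↦
      hyX ⟨y₂, h, hτ.eq_of_mem_right hk (.inr (hXC h)) (mem_insert _ _)⟩
    rw [himg]
    generalize τ '' X = T at *
    constructor
    · refine ⟨y₁, hy₁, by grind, ?_⟩
      convert hb₁ using 1
      grind
    · refine ⟨y₂, hy₂, by grind, ?_⟩
      convert hb₂ using 1
      grind

/-- Principal extension preserves `k`-base-orderability. -/
lemma IsBaseOrderable.princExt (hk : 1 ≤ k) (h : IsBaseOrderable k M) :
    IsBaseOrderable k (princExt M Y e he) := by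
  intro B₁ B₂ hB₁ hB₂
  have : Nonempty α := ⟨e⟩
  have split : ∀ B : Set α, e ∈ B → ∃ C, B = insert e C ∧ e ∉ C := by
    intro B hB
    exact ⟨B \ {e}, by simp [hB], by simp⟩
  by_cases he₁ : e ∈ B₁ <;> by_cases he₂ : e ∈ B₂
  · obtain ⟨C₁, rfl, heC₁⟩ := split B₁ he₁
    obtain ⟨C₂, rfl, heC₂⟩ := split B₂ he₂
    obtain ⟨y₁, hy₁, hyC₁, hB₁⟩ := (princExt_insert_isBase_iff heC₁).1 hB₁
    obtain ⟨y₂, hy₂, hyC₂, hB₂⟩ := (princExt_insert_isBase_iff heC₂).1 hB₂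
    obtain ⟨τ, hτ⟩ := h _ _ hB₁ hB₂
    exact exists_isExchangeOrdering_insert_insert hk hy₁ hy₂ hyC₁ hyC₂ hτ
  · obtain ⟨C₁, rfl, heC₁⟩ := split B₁ he₁
    obtain ⟨y₁, hy₁, hyC₁, hB₁⟩ := (princExt_insert_isBase_iff heC₁).1 hB₁
    obtain ⟨τ, hτ⟩ := h _ _ ((princExt_isBase_iff he₂).1 hB₂) hB₁
    obtain ⟨σ, hσ⟩ := exists_isExchangeOrdering_insert_right (he := he) hk hy₁ hyC₁ hτ
    exact ⟨_, hσ.symm⟩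
  · obtain ⟨C₂, rfl, heC₂⟩ := split B₂ he₂
    obtain ⟨y₂, hy₂, hyC₂, hB₂⟩ := (princExt_insert_isBase_iff heC₂).1 hB₂
    obtain ⟨τ, hτ⟩ := h _ _ ((princExt_isBase_iff he₁).1 hB₁) hB₂
    exact exists_isExchangeOrdering_insert_right hk hy₂ hyC₂ hτ
  · obtain ⟨τ, hτ⟩ := h _ _ ((princExt_isBase_iff he₁).1 hB₁) ((princExt_isBase_iff he₂).1 hB₂)
    refine ⟨τ, hτ.1, fun X hX hXk ↦ ?_⟩
    obtain ⟨hb₁, hb₂⟩ := hτ.2 X hX hXk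
    rw [princExt_isBase_iff fun h ↦ he (hb₁.subset_ground h),
      princExt_isBase_iff fun h ↦ he (hb₂.subset_ground h)]
    exact ⟨hb₁, hb₂⟩

lemma kBO.princExt (hk : 1 ≤ k) (h : kBO k M) : kBO k (princExt M Y e he) :=
  ⟨inferInstance, h.2.princExt hk⟩

end PrincipalExtension

/-! ### Truncations -/

section Truncation

variable {α : Type u} {M T : Matroid α} {k : ℕ}

lemma kBO.mapEmbedding {β : Type u} (h : kBO k M) (f : α ↪ β) : kBO k (M.mapEmbedding f) :=
  h.map f _

lemma exists_isTruncation [M.Finite] : ∃ T : Matroid α, IsTruncation M T := by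
  have : (M.mapEmbedding (.some : α ↪ Option α)).Finite := ⟨M.ground_finite.image _⟩
  have hnone : none ∉ (M.mapEmbedding (.some : α ↪ Option α)).E := by simp
  set N := princExt (M.mapEmbedding (.some : α ↪ Option α)) (M.mapEmbedding .some).E none hnone
    with hN
  refine ⟨(N ／ {none}).comap some, N, isPrincipalExtension_princExt subset_rfl, ?_⟩
  refine Matroid.map_comap (f := some) ?_ (Option.some_injective α).injOn
  rintro (_ | x) hx
  · exact absurd rfl hx.2
  · exact ⟨x, rfl⟩

lemma kBO.of_isTruncation (hk : 1 ≤ k) (h : kBO k M) (hT : IsTruncation M T) : kBO k T := by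
  obtain ⟨N, hN, hTN⟩ := hT
  have := h.1
  have : (M.mapEmbedding (.some : α ↪ Option α)).Finite := ⟨M.ground_finite.image _⟩
  refine kBO.of_mapEmbedding .some ?_
  rw [hTN, hN.eq_princExt]
  exact ((h.mapEmbedding _).princExt hk).contract hk _

end Truncation

/-! ### Induction by bipartite graphs -/

section BipartiteInduction

variable {V : Type u} {M : Matroid V} {R : V → Set V} {k : ℕ}

/-- `f` matches `I` injectively into neighbours with respect to `R` such that the image is
independent in `M`. -/
structure IsIndepMatching (M : Matroid V) (R : V → Set V) (f : V → V) (I : Set V) : Prop where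
  injOn : InjOn f I
  mem : ∀ v ∈ I, f v ∈ R v
  indep : M.Indep (f '' I)

/-- The elements of `A` are added to `M` one at a time, by principal extensions along their
neighbourhoods. To keep old and new elements apart, the ground set of `M` is copied along `inr`, and
`A` along `inl`. -/
lemma exists_kBO_sum_indep_iff [Finite V] (hk : 1 ≤ k) (hM : kBO k M) (R : V → Set V) (A : Set V) :
    ∃ N : Matroid (V ⊕ V), kBO k N ∧ N.E = Sum.inl '' A ∪ Sum.inr '' M.E ∧
      ∀ I ⊆ A, ∀ K, N.Indep (Sum.inl '' I ∪ Sum.inr '' K) ↔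
        ∃ f : V → V, InjOn f I ∧ (∀ v ∈ I, f v ∈ R v) ∧ Disjoint (f '' I) K ∧
          M.Indep (f '' I ∪ K) := by
  classical
  induction A, A.toFinite using Set.Finite.induction_on with
  | empty =>
    refine ⟨M.mapEmbedding .inr, hM.mapEmbedding _, by simp, fun I hI K ↦ ?_⟩
    obtain rfl := subset_empty_iff.1 hI
    simp only [image_empty, empty_union, injOn_empty, mem_empty_iff_false, false_implies,
      implies_true, empty_disjoint, true_and]
    refine ⟨fun ⟨K', hK', hKK'⟩ ↦ ⟨id, ?_⟩, fun ⟨_, h⟩ ↦ h.mapEmbedding _⟩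
    rwa [Sum.inr_injective.image_injective hKK']
  | @insert a A ha _ ih =>
    obtain ⟨N, hN, hNE, hNI⟩ := ih
    have := hN.1
    have he : Sum.inl a ∉ N.E := by simp [hNE, ha]
    refine ⟨princExt N (Sum.inr '' R a) (Sum.inl a) he, hN.princExt hk, ?_, fun I hI K ↦ ?_⟩
    · rw [princExt_ground, hNE, image_insert_eq, insert_union]
    by_cases haI : a ∈ I
    · obtain ⟨I, rfl, haI'⟩ : ∃ I', I = insert a I' ∧ a ∉ I' := ⟨I \ {a}, by simp [haI], by simp⟩
      have hIA : I ⊆ A := (insert_subset_insert_iff haI').1 hI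
      have hins : ∀ w, insert (Sum.inr w) (Sum.inl '' I ∪ Sum.inr '' K) =
          (Sum.inl '' I ∪ Sum.inr '' (insert w K) : Set (V ⊕ V)) := fun w ↦ by
        rw [image_insert_eq, union_insert]
      rw [image_insert_eq, insert_union, princExt_insert_indep_iff (by simp [haI'])]
      simp only [exists_mem_image, hins, hNI I hIA]
      constructor
      · rintro ⟨w, hw, hwK, f, hf, hfR, hd, hi⟩
        have hfa : ∀ v ∈ I, Function.update f a w v = f v := fun v hv ↦
          Function.update_of_ne (ne_of_mem_of_not_mem hv haI') _ _
        have himg : Function.update f a w '' I = f '' I := image_congr hfa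
        rw [disjoint_insert_right] at hd
        refine ⟨Function.update f a w, ?_, ?_, ?_, ?_⟩
        · rw [injOn_insert haI', himg, Function.update_self]
          exact ⟨hf.congr fun v hv ↦ (hfa v hv).symm, hd.1⟩
        · rintro v (rfl | hv)
          · rwa [Function.update_self]
          · rw [hfa v hv]; exact hfR v hv
        · rw [image_insert_eq, himg, Function.update_self, disjoint_insert_left]
          exact ⟨by simpa using hwK, hd.2⟩
        · rwa [image_insert_eq, himg, Function.update_self, insert_union, ← union_insert]
      · rintro ⟨f, hf, hfR, hd, hi⟩
        rw [injOn_insert haI'] at hf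
        rw [image_insert_eq, disjoint_insert_left] at hd
        refine ⟨f a, hfR a (mem_insert _ _), by simpa using hd.1, f, hf.1,
          fun v hv ↦ hfR v (.inr hv), disjoint_insert_right.2 ⟨hf.2, hd.2⟩, ?_⟩
        rwa [union_insert, ← insert_union, ← image_insert_eq]
    · rw [princExt_indep_iff (by simp [haI])]
      exact hNI I ((subset_insert_iff_of_notMem haI).1 hI) K

/-- The matroid induced from a `k`-base-orderable matroid by a bipartite graph is
`k`-base-orderable. -/
lemma exists_kBO_indep_iff [Finite V] (hk : 1 ≤ k) (hM : kBO k M) (R : V → Set V) :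
    ∃ N : Matroid V, kBO k N ∧ N.E = univ ∧ ∀ I, N.Indep I ↔ ∃ f, IsIndepMatching M R f I := by
  obtain ⟨N, hN, hNE, hNI⟩ := exists_kBO_sum_indep_iff hk hM R univ
  have hr : range Sum.inl ⊆ N.E := by rw [hNE, image_univ]; exact subset_union_left
  refine ⟨(N ↾ range Sum.inl).comap Sum.inl, ?_, by simp, fun I ↦ ?_⟩
  · refine kBO.of_mapEmbedding (.inl : V ↪ V ⊕ V) ?_
    have : ((N ↾ range Sum.inl).comap Sum.inl).mapEmbedding .inl = N ↾ range Sum.inl :=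
      Matroid.map_comap (f := Sum.inl) subset_rfl Sum.inl_injective.injOn
    rw [this]
    exact hN.restrict hk hr
  · rw [Matroid.comap_indep_iff, Matroid.restrict_indep_iff, and_iff_left (image_subset_range _ _),
      and_iff_left Sum.inl_injective.injOn]
    have := hNI I (subset_univ _) ∅
    rw [image_empty, union_empty] at this
    rw [this]
    refine exists_congr fun f ↦ ⟨fun ⟨h1, h2, _, h3⟩ ↦ ⟨h1, h2, by simpa using h3⟩,
      fun h ↦ ⟨h.injOn, h.mem, by simp, by simpa using h.indep⟩⟩

end BipartiteInduction

/-! ### Linkings as matchings of the complements -/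

section Linking

variable {V : Type u} {Γ : Digraph V} {I J : Set V}

lemma IsLinked.ncard_eq (h : IsLinked Γ I J) : I.ncard = J.ncard := by
  obtain ⟨t, p, ht, -⟩ := h
  rw [← ht.image_eq, ht.injOn.ncard_image]

lemma IsLinked.exists_subset (h : IsLinked Γ I J) {I' : Set V} (hI : I' ⊆ I) :
    ∃ J' ⊆ J, IsLinked Γ I' J' := by
  obtain ⟨t, p, ht, hp, hd⟩ := h
  exact ⟨t '' I', (image_mono hI).trans ht.image_eq.subset, t, p, (ht.injOn.mono hI).bijOn_image,
    fun x hx ↦ hp x (hI hx), fun x hx x' hx' ↦ hd x (hI hx) x' (hI hx')⟩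

/-- `f` is a bijection between the complements of `I` and `J` that moves each vertex at most to an
in-neighbour. -/
structure IsBackMatching (Γ : Digraph V) (f : V → V) (I J : Set V) : Prop where
  bijOn : BijOn f Iᶜ Jᶜ
  adj : ∀ v ∈ Iᶜ, f v = v ∨ Γ.Adj (f v) v

/-- A vertex on a path goes to its predecessor, and a vertex on no path stays where it is. -/
lemma IsLinked.exists_isBackMatching [Finite V] (h : IsLinked Γ I J) :
    ∃ f, IsBackMatching Γ f I J := by
  have hcard := h.ncard_eq
  obtain ⟨t, p, ht, hp, hd⟩ := h
  have huniq : ∀ x ∈ I, ∀ x' ∈ I, ∀ v, v ∈ p x → v ∈ p x' → x = x' := by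
    intro x hx x' hx' v hv hv'
    by_contra hne
    exact hd x hx x' hx' hne hv hv'
  have hidx : ∀ x ∈ I, ∀ (i j : ℕ) (v : V), (p x)[i]? = some v → (p x)[j]? = some v → i = j := by
    intro x hx i j v hi hj
    obtain ⟨hi', -⟩ := List.getElem?_eq_some_iff.1 hi
    exact (List.getElem?_inj hi' (hp x hx).nodup).1 (hi.trans hj.symm)
  have hex : ∀ v, ∃ u, v ∈ Iᶜ → (u = v ∧ ∀ x ∈ I, v ∉ p x) ∨
      ∃ x ∈ I, ∃ i, (p x)[i]? = some u ∧ (p x)[i + 1]? = some v := by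
    intro v
    by_cases hv : ∃ x ∈ I, v ∈ p x
    · obtain ⟨x, hx, hvx⟩ := hv
      obtain ⟨i, hi⟩ := List.mem_iff_getElem?.1 hvx
      obtain _ | i := i
      · refine ⟨v, fun hvI ↦ absurd hx ?_⟩
        have h0 := (hp x hx).head_eq
        rw [List.head?_eq_getElem?, hi, Option.some_inj] at h0
        exact h0 ▸ hvI
      · obtain ⟨hlt, -⟩ := List.getElem?_eq_some_iff.1 hi
        exact ⟨(p x)[i], fun _ ↦ .inr ⟨x, hx, i, List.getElem?_eq_getElem _, hi⟩⟩
    · push Not at hv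
      exact ⟨v, fun _ ↦ .inl ⟨rfl, hv⟩⟩
  choose f hf using hex
  have hinj : InjOn f Iᶜ := by
    intro v hv w hw hvw
    obtain ⟨h1, h2⟩ | ⟨x, hx, i, h1, h2⟩ := hf v hv <;>
      obtain ⟨h3, h4⟩ | ⟨y, hy, j, h3, h4⟩ := hf w hw
    · rw [← h1, ← h3, hvw]
    · rw [← hvw, h1] at h3
      exact absurd (List.mem_of_getElem? h3) (h2 y hy)
    · rw [hvw, h3] at h1
      exact absurd (List.mem_of_getElem? h1) (h4 x hx)
    · rw [hvw] at h1
      obtain rfl := huniq x hx y hy _ (List.mem_of_getElem? h1) (List.mem_of_getElem? h3)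
      obtain rfl := hidx x hx _ _ _ h1 h3
      exact Option.some_inj.1 (h2.symm.trans h4)
  have hmaps : MapsTo f Iᶜ Jᶜ := by
    intro v hv hfJ
    obtain ⟨y, hy, hyf⟩ := ht.surjOn hfJ
    have hlast := (hp y hy).last_eq
    rw [List.getLast?_eq_getElem?, hyf] at hlast
    have hmem := List.mem_of_getElem? hlast
    obtain ⟨h1, h2⟩ | ⟨x, hx, i, h1, h2⟩ := hf v hv
    · exact h2 y hy (h1 ▸ hmem)
    · obtain rfl := huniq x hx y hy _ (List.mem_of_getElem? h1) hmem
      have := hidx x hx _ _ _ h1 hlast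
      obtain ⟨hlt, -⟩ := List.getElem?_eq_some_iff.1 h2
      omega
  refine ⟨f, ⟨⟨hmaps, hinj, ?_⟩, fun v hv ↦ ?_⟩⟩
  · have hc : (Iᶜ : Set V).ncard = (Jᶜ : Set V).ncard := by
      rw [ncard_compl, ncard_compl, hcard]
    have : f '' Iᶜ = Jᶜ := eq_of_subset_of_ncard_le hmaps.image_subset
      (by rw [hinj.ncard_image, hc])
    exact this.symm.subset
  · obtain ⟨h1, -⟩ | ⟨x, hx, i, h1, h2⟩ := hf v hv
    · exact .inl h1
    · obtain ⟨hi, h1⟩ := List.getElem?_eq_some_iff.1 h1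
      obtain ⟨hi', h2⟩ := List.getElem?_eq_some_iff.1 h2
      have := List.isChain_iff_getElem.1 (hp x hx).isChain i hi'
      rw [h1, h2] at this
      exact .inr this

/-- The paths are the orbits of the inverse of `f` that start in `I`, up to their first vertex in
`J`. -/
lemma IsBackMatching.isLinked [Finite V] {f : V → V} (h : IsBackMatching Γ f I J) :
    IsLinked Γ I J := by
  classical
  obtain hV | hV := isEmpty_or_nonempty V
  · refine ⟨id, fun _ ↦ [], ?_, fun x ↦ isEmptyElim x, fun x ↦ isEmptyElim x⟩
    rw [Subsingleton.elim J I]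
    exact bijOn_id _
  set g := Function.invFunOn f Iᶜ
  have hinv : InvOn g f Iᶜ Jᶜ := h.bijOn.invOn_invFunOn
  have hg : BijOn g Jᶜ Iᶜ := h.bijOn.symm hinv.symm
  have hfg : ∀ u, u ∉ J → f (g u) = u := fun u hu ↦ hinv.2 hu
  have hex : ∀ x ∈ I, ∃ n, g^[n] x ∈ J := by
    intro x hx
    by_contra! hno
    have hcancel : ∀ i j, g^[i] x = g^[j] x → i = j := by
      intro i
      induction i with
      | zero =>
        rintro (_ | j) hij
        · rfl
        · rw [Function.iterate_succ_apply'] at hij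
          exact absurd (hij ▸ hx) (hg.mapsTo (hno j))
      | succ i ih =>
        rintro (_ | j) hij
        · rw [Function.iterate_succ_apply'] at hij
          exact absurd (hij ▸ hx) (hg.mapsTo (hno i))
        · rw [Function.iterate_succ_apply', Function.iterate_succ_apply'] at hij
          rw [ih j (hg.injOn (hno i) (hno j) hij)]
    exact not_injective_infinite_finite (fun n ↦ g^[n] x) fun i j hij ↦ hcancel i j hij
  have hex' : ∀ x, ∃ n, x ∈ I → g^[n] x ∈ J ∧ ∀ m < n, g^[m] x ∉ J := by
    intro x
    by_cases hx : x ∈ I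
    · exact ⟨Nat.find (hex x hx), fun _ ↦ ⟨Nat.find_spec (hex x hx),
        fun m hm ↦ Nat.find_min (hex x hx) hm⟩⟩
    · exact ⟨0, fun h ↦ absurd h hx⟩
  choose n hn using hex'
  have hnotI : ∀ x ∈ I, ∀ m, m + 1 ≤ n x → g^[m + 1] x ∉ I := by
    intro x hx m hm
    rw [Function.iterate_succ_apply']
    exact hg.mapsTo ((hn x hx).2 m hm)
  -- An orbit enters `Iᶜ` after one step and `g` is injective, so orbits never meet.
  have hcancel : ∀ x ∈ I, ∀ x' ∈ I, ∀ i j, i ≤ n x → j ≤ n x' → g^[i] x = g^[j] x' →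
      x = x' ∧ i = j := by
    intro x hx x' hx' i
    induction i with
    | zero =>
      rintro (_ | j) hi hj hij
      · exact ⟨hij, rfl⟩
      · exact absurd (hij ▸ hx) (hnotI x' hx' j hj)
    | succ i ih =>
      rintro (_ | j) hi hj hij
      · exact absurd (hij ▸ hx') (hnotI x hx i hi)
      · rw [Function.iterate_succ_apply', Function.iterate_succ_apply'] at hij
        have := ih j (by omega) (by omega)
          (hg.injOn ((hn x hx).2 i hi) ((hn x' hx').2 j hj) hij)
        exact ⟨this.1, by rw [this.2]⟩
  have hcard : I.ncard = J.ncard := by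
    have h1 : (Iᶜ : Set V).ncard = (Jᶜ : Set V).ncard := by
      rw [← h.bijOn.image_eq, h.bijOn.injOn.ncard_image]
    have h2 := ncard_add_ncard_compl I
    have h3 := ncard_add_ncard_compl J
    omega
  refine ⟨fun x ↦ g^[n x] x, fun x ↦ (List.range (n x + 1)).map fun i ↦ g^[i] x, ?_, ?_, ?_⟩
  · have hmaps : MapsTo (fun x ↦ g^[n x] x) I J := fun x hx ↦ (hn x hx).1
    have hinj : InjOn (fun x ↦ g^[n x] x) I := fun x hx x' hx' hxx ↦
      (hcancel x hx x' hx' _ _ le_rfl le_rfl hxx).1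
    refine ⟨hmaps, hinj, ?_⟩
    exact (eq_of_subset_of_ncard_le hmaps.image_subset
      (by rw [hinj.ncard_image, hcard])).symm.subset
  · intro x hx
    refine ⟨?_, ?_, ?_, ?_⟩
    · rw [List.isChain_iff_getElem]
      intro i hi
      simp only [List.length_map, List.length_range] at hi
      simp only [List.getElem_map, List.getElem_range]
      have hiJ := (hn x hx).2 i (by omega)
      have hadj := h.adj _ (hg.mapsTo hiJ)
      rw [hfg _ hiJ, ← Function.iterate_succ_apply' g] at hadj
      refine hadj.resolve_left fun heq ↦ ?_
      have := (hcancel x hx x hx i (i + 1) (by omega) (by omega) heq).2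
      omega
    · refine List.Nodup.map_on (fun i hi j hj hij ↦ ?_) List.nodup_range
      rw [List.mem_range] at hi hj
      exact (hcancel x hx x hx i j (by omega) (by omega) hij).2
    · simp [List.head?_eq_getElem?]
    · rw [List.getLast?_eq_getElem?]
      simp only [List.length_map, List.length_range, Nat.add_sub_cancel]
      simp only [List.getElem?_map, List.getElem?_range (Nat.lt_succ_self (n x)), Option.map_some]
  · intro x hx x' hx' hne v hv hv'
    simp only [List.mem_map, List.mem_range] at hv hv'
    obtain ⟨i, hi, rfl⟩ := hv
    obtain ⟨j, hj, hij⟩ := hv'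
    exact hne (hcancel x hx x' hx' i j (by omega) (by omega) hij.symm).1

end Linking

/-! ### Induction by directed graphs -/

section Induction

variable {V : Type u} {M N : Matroid V} {Γ : Digraph V} {k : ℕ}

/-- Adding loops preserves `k`-base-orderability. -/
lemma kBO.restrict_univ [Finite V] (h : kBO k M) : kBO k (M ↾ univ) := by
  have hb : ∀ B, (M ↾ univ).IsBase B ↔ M.IsBase B := fun B ↦ by
    simp [Matroid.isBase_iff_maximal_indep, Maximal]
  refine ⟨⟨toFinite _⟩, fun B₁ B₂ hB₁ hB₂ ↦ ?_⟩
  obtain ⟨σ, hσ⟩ := h.2 B₁ B₂ ((hb _).1 hB₁) ((hb _).1 hB₂)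
  exact ⟨σ, hσ.1, by simpa only [hb] using hσ.2⟩

/-- The induced matroid is the dual of the matroid that is induced from the dual of `M` by the
bipartite graph joining each vertex to itself and to its in-neighbours. -/
lemma kBO.exists_isInduced [Finite V] (hk : 1 ≤ k) (hM : kBO k M) (Γ : Digraph V) :
    ∃ N : Matroid V, IsInduced Γ M N ∧ kBO k N := by
  set M₀ := M ↾ univ with hM₀
  have hM₀I : ∀ I, M₀.Indep I ↔ M.Indep I := by simp [hM₀]
  have hkM₀ : kBO k M₀ := hM.restrict_univ
  obtain ⟨N, hN, hNE, hNI⟩ := exists_kBO_indep_iff hk (hkM₀.dual hk) fun v ↦ {w | w = v ∨ Γ.Adj w v}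
  have := hN.1
  have : M₀✶.Finite := (hkM₀.dual hk).1
  have hrank : N.eRank = M₀✶.eRank := by
    apply le_antisymm
    · obtain ⟨B, hB⟩ := N.exists_isBase
      obtain ⟨f, hf⟩ := (hNI B).1 hB.indep
      rw [← hB.encard_eq_eRank, ← hf.injOn.encard_image]
      exact hf.indep.encard_le_eRank
    · obtain ⟨B, hB⟩ := M₀✶.exists_isBase
      rw [← hB.encard_eq_eRank]
      refine Matroid.Indep.encard_le_eRank ((hNI B).2 ⟨id, injOn_id _, fun v _ ↦ .inl rfl, ?_⟩)
      rw [image_id]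
      exact hB.indep
  have hdual : ∀ B, M₀✶.IsBase Bᶜ ↔ M₀.IsBase B := by
    intro B
    rw [Matroid.dual_isBase_iff']
    simp [hM₀]
  have hdualN : ∀ B, N✶.IsBase B ↔ N.IsBase Bᶜ := by
    intro B
    rw [Matroid.dual_isBase_iff']
    simp [hNE, ← compl_eq_univ_sdiff]
  refine ⟨N✶, ⟨hNE, fun I ↦ ⟨fun hI ↦ ?_, fun ⟨J, hJ, hIJ⟩ ↦ ?_⟩⟩, hN.dual hk⟩
  · obtain ⟨B, hB, hIB⟩ := hI.exists_isBase_superset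
    rw [hdualN, isBase_iff_indep_encard_eq] at hB
    obtain ⟨f, hf⟩ := (hNI _).1 hB.1
    have hb : M₀✶.IsBase (f '' Bᶜ) := by
      rw [isBase_iff_indep_encard_eq, hf.injOn.encard_image, hB.2]
      exact ⟨hf.indep, hrank⟩
    have hlink : IsBackMatching Γ f B (f '' Bᶜ)ᶜ := by
      refine ⟨?_, hf.mem⟩
      rw [compl_compl]
      exact hf.injOn.bijOn_image
    rw [← compl_compl (f '' Bᶜ), hdual] at hb
    obtain ⟨J, hJ, hIJ⟩ := hlink.isLinked.exists_subset hIB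
    exact ⟨J, (hM₀I J).1 (hb.indep.subset hJ), hIJ⟩
  · -- `f` matches some `D ⊆ Iᶜ` with the complement of a base `B` of `M` that contains `J`.
    obtain ⟨B, hB, hJB⟩ := ((hM₀I J).2 hJ).exists_isBase_superset
    obtain ⟨f, hf⟩ := hIJ.exists_isBackMatching
    rw [← hdual] at hB
    obtain ⟨D, hDI, hD⟩ : ∃ D ⊆ Iᶜ, f '' D = Bᶜ :=
      subset_image_iff.1 ((compl_subset_compl.2 hJB).trans hf.bijOn.image_eq.symm.subset)
    have hinj := hf.bijOn.injOn.mono hDI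
    have hDN : N.IsBase D := by
      rw [isBase_iff_indep_encard_eq, hNI]
      refine ⟨⟨f, hinj, fun v hv ↦ hf.adj v (hDI hv), hD ▸ hB.indep⟩, ?_⟩
      rw [← hinj.encard_image, hD, hrank, hB.encard_eq_eRank]
    rw [← compl_compl D, ← hdualN] at hDN
    exact hDN.indep.subset (subset_compl_comm.1 hDI)

lemma IsInduced.unique {N' : Matroid V} (h : IsInduced Γ M N) (h' : IsInduced Γ M N') : N = N' :=
  Matroid.ext_indep (h.1.trans h'.1.symm) fun I _ ↦ (h.2 I).trans (h'.2 I).symm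

end Induction
end MatroidClass

theorem mainTheorem1 (k : ℕ) (hk : 1 ≤ k) : MatroidClass.IsComplete.{u} (MatroidClass.kBO.{u} k) where
  finite _ h := h.1
  isomorphic _ _ h hMN := h.of_isIsomorphic hMN
  minor _ _ h hN := h.isMinor hk hN
  dual _ h := h.dual hk
  directSum _ _ hM hN := hM.sum hN
  truncation _ h := by
    have := h.1
    exact ⟨MatroidClass.exists_isTruncation, fun _ hT ↦ h.of_isTruncation hk hT⟩
  induction Γ _ h := by
    obtain ⟨N, hN, hkN⟩ := h.exists_isInduced hk Γ
    exact ⟨⟨N, hN⟩, fun N' hN' ↦ hN.unique hN' ▸ hkN⟩
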